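/- Let $G$ be a finite directed acyclic graph whose nodes are variables with finitely many states, with a conditional probability table $P(v\mid \mathrm{pa}(v))$ for every node $v$, where $\mathrm{pa}(v)$ are the parents of $v$. Let $P=\prod_v P(v\mid \mathrm{pa}(v))$ be the resulting joint distribution. For a node $X$ and a state $x$ of it, let $P(\cdot\mid do(x))$ be the distribution obtained by deleting the factor of $X$ from this product and setting $X=x$. A path (a sequence of distinct nodes, consecutive ones being joined by an arrow in either direction) is blocked by a set $Z$ of nodes if it contains a chain $A\to B\to C$ or a fork $A\leftarrow B\to C$ (with $A,B,C$ consecutive on the path, in either order) with $B\in Z$, or a collider $A\to B\leftarrow C$ such that neither $B$ nor any descendant of $B$ is in $Z$. The set $Z$ satisfies the back-door criterion relative to $(X,Y)$ if no node of $Z$ is $X$ or a descendant of $X$, and $Z$ blocks every path between $X$ and $Y$ that contains an arrow into $X$. Let $X\neq Y$ be nodes and let $W,U$ be sets of nodes such that $W\cup U$ satisfies the back-door criterion relative to $(X,Y)$. Fix states $x$ of $X$ and $y$ of $Y$, and suppose that $P(x,w,u)>0$ for all values $w$ of $W$ and $u$ of $U$ with $P(w,u)>0$. Given only the tables $P(X,Y,W)$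 and $P(U)$, consider real variables $a_{w,u},b_{w,u},c_{w,u}$ (one triple for every value $w$ of $W$ and $u$ of $U$) subject to $$\sum_u a_{w,u}=P(x,y,w),\qquad \sum_u b_{w,u}=P(w),\qquad \sum_u c_{w,u}=P(x,w)\qquad\text{for all } w,$$ and, for all $w$ and $u$, $$b_{w,u}\ge c_{w,u}\ge a_{w,u},$$ $$\max\{0,P(x,y,w)+P(u)-1\}\le a_{w,u}\le\min\{P(x,y,w),P(u)\},$$ $$\max\{0,P(w)+P(u)-1\}\le b_{w,u}\le\min\{P(w),P(u)\},$$ $$\max\{0,P(x,w)+P(u)-1\}\le c_{w,u}\le\min\{P(x,w),P(u)\}.$$ Let $\mathrm{LB}$ and $\mathrm{UB}$ be the infimum and the supremum (the minimum and the maximum when attained) of $$\sum_{w,u}\frac{a_{w,u}\,b_{w,u}}{c_{w,u}}$$ over all such points at which this objective is defined, i.e. at which $c_{w,u}=0$ only where $b_{w,u}=0$; a term with $a_{w,u}=b_{w,u}=c_{w,u}=0$ counts as $0$. Then the set of these points is nonempty, the objective is bounded on it, and $$\mathrm{LB}\le P(y\mid do(x))\le \mathrm{UB}.$$ -/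

import Mathlib

open Finset

/-! Causal diagrams, paths, blocking and the back-door criterion. -/

/-- A directed graph is acyclic if no node can be reached from itself by a nontrivial directed
path. -/
def Digraph.IsAcyclicDigraph {V : Type*} (G : Digraph V) : Prop :=
  ∀ v, ¬ Relation.TransGen G.Adj v v

/-- `D` is a descendant of `B` (every node is a descendant of itself). -/
def Digraph.IsDescendant {V : Type*} (G : Digraph V) (B D : V) : Prop :=
  Relation.ReflTransGen G.Adj B D

/-- `p` is a path between `A` and `B`: a list of distinct nodes from `A` to `B`, any two
consecutive nodes being joined by an arrow in one of the two directions. In an acyclic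
graph the nodes determine the arrows. -/
structure Digraph.IsPath {V : Type*} (G : Digraph V) (A B : V) (p : List V) : Prop where
  chain : p.IsChain (fun u v => G.Adj u v ∨ G.Adj v u)
  nodup : p.Nodup
  head : p.head? = some A
  last : p.getLast? = some B

/-- The path `p` is blocked by `Z`: it contains a chain or a fork whose middle node is in `Z`,
or a collider such that neither the collision node nor any of its descendants is in `Z`. -/
def Digraph.IsBlocked {V : Type*} (G : Digraph V) (Z : Finset V) (p : List V) : Prop :=
  ∃ A B C, [A, B, C] <:+: p ∧
    ((((G.Adj A B ∧ G.Adj B C) ∨ (G.Adj C B ∧ G.Adj B A) ∨ (G.Adj B A ∧ G.Adj B C)) ∧ B ∈ Z) ∨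
      ((G.Adj A B ∧ G.Adj C B) ∧ ∀ D, G.IsDescendant B D → D ∉ Z))

/-- The back-door criterion for `Z` relative to the ordered pair `(X, Y)`: no node of `Z` is a
descendant of `X`, and `Z` blocks every path between `X` and `Y` that contains an arrow
into `X`. -/
structure Digraph.BackDoor {V : Type*} (G : Digraph V) (X Y : V) (Z : Finset V) : Prop where
  not_descendant : ∀ v ∈ Z, ¬ G.IsDescendant X v
  blocked : ∀ p, G.IsPath X Y p → (∃ A, [X, A] <+: p ∧ G.Adj A X) → G.IsBlocked Z p

/-! Distributions compatible with a causal diagram, and interventions. -/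

/-- A causal model on the diagram `G` with finite state spaces `S v`: for every node `v` a
conditional probability table `P(v | parents of v)`. -/
structure CausalModel {V : Type*} (G : Digraph V) (S : V → Type*) [∀ v, Fintype (S v)] where
  cpt : ∀ v, (∀ u : {u // G.Adj u v}, S u) → S v → ℝ
  cpt_nonneg : ∀ v pa s, 0 ≤ cpt v pa s
  cpt_sum : ∀ v pa, ∑ s, cpt v pa s = 1

namespace CausalModel

variable {V : Type*} [Fintype V] [DecidableEq V] {G : Digraph V} {S : V → Type*}
  [∀ v, Fintype (S v)]

/-- The factor `P(v | parents of v)` at the joint assignment `ω`. -/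
def factor (M : CausalModel G S) (v : V) (ω : ∀ v, S v) : ℝ :=
  M.cpt v (fun u => ω u) (ω v)

/-- The joint distribution compatible with `G`: the product of all factors. -/
def joint (M : CausalModel G S) (ω : ∀ v, S v) : ℝ :=
  ∏ v, M.factor v ω

/-- The post-intervention distribution under `do(X = x)`: the truncated factorization, in which
the factor of `X` is deleted and `X` is set to `x`. -/
noncomputable def doJoint (M : CausalModel G S) (X : V) (x : S X) (ω : ∀ v, S v) : ℝ :=
  {ω : ∀ v, S v | ω X = x}.indicator (fun ω => ∏ v ∈ univ.erase X, M.factor v ω) ω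

/-- The probability of the event `E` in the observational distribution. -/
noncomputable def prob (M : CausalModel G S) (E : Set (∀ v, S v)) : ℝ :=
  ∑ ω, E.indicator M.joint ω

/-- The probability of the event `E` under the intervention `do(X = x)`. -/
noncomputable def doProb (M : CausalModel G S) (X : V) (x : S X) (E : Set (∀ v, S v)) : ℝ :=
  ∑ ω, E.indicator (M.doJoint X x) ω

/-- The causal effect `P(y | do(x))`. -/
noncomputable def causalEffect (M : CausalModel G S) (X Y : V) (x : S X) (y : S Y) : ℝ :=
  M.doProb X x {ω | ω Y = y}

/-- The observed table `P(X, Y, W)`. -/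
noncomputable def tableXYW (M : CausalModel G S) (X Y : V) (W : Finset V)
    (x : S X) (y : S Y) (w : ∀ v : W, S v) : ℝ :=
  M.prob {ω | ω X = x ∧ ω Y = y ∧ W.restrict ω = w}

/-- The observed table `P(U)`. -/
noncomputable def tableU (M : CausalModel G S) (U : Finset V) (u : ∀ v : U, S v) : ℝ :=
  M.prob {ω | U.restrict ω = u}

end CausalModel

/-! The optimization problem. It is a function of the two tables `q = P(X, Y, W)` and `r = P(U)`
only. Here `𝒳`, `𝒴`, `𝒲`, `𝒰` are the sets of values of `X`, `Y`, `W`, `U`. -/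

/-- The constraints on the variables `a`, `b`, `c`. The marginals `P(w)` and `P(x, w)` are
computed from the table `q`. -/
structure IsFeasible {𝒳 𝒴 𝒲 𝒰 : Type*} [Fintype 𝒳] [Fintype 𝒴] [Fintype 𝒰]
    (q : 𝒳 → 𝒴 → 𝒲 → ℝ) (r : 𝒰 → ℝ) (x : 𝒳) (y : 𝒴) (a b c : 𝒲 → 𝒰 → ℝ) : Prop where
  sum_a : ∀ w, ∑ u, a w u = q x y w
  sum_b : ∀ w, ∑ u, b w u = ∑ x', ∑ y', q x' y' w
  sum_c : ∀ w, ∑ u, c w u = ∑ y', q x y' w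
  c_le_b : ∀ w u, c w u ≤ b w u
  a_le_c : ∀ w u, a w u ≤ c w u
  le_a : ∀ w u, max 0 (q x y w + r u - 1) ≤ a w u
  a_le : ∀ w u, a w u ≤ min (q x y w) (r u)
  le_b : ∀ w u, max 0 ((∑ x', ∑ y', q x' y' w) + r u - 1) ≤ b w u
  b_le : ∀ w u, b w u ≤ min (∑ x', ∑ y', q x' y' w) (r u)
  le_c : ∀ w u, max 0 ((∑ y', q x y' w) + r u - 1) ≤ c w u
  c_le : ∀ w u, c w u ≤ min (∑ y', q x y' w) (r u)

/-- The set of values of the objective `∑ a b / c` over the feasible points at which it is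
defined. A term with `c = 0 < b` is undefined (`0 / 0`), and such points are left out; a term
with `b = 0`, hence `a = c = 0`, stands for `P(y | x, w, u) * 0` and counts as `0`. -/
def objectiveValues {𝒳 𝒴 𝒲 𝒰 : Type*} [Fintype 𝒳] [Fintype 𝒴] [Fintype 𝒲] [Fintype 𝒰]
    (q : 𝒳 → 𝒴 → 𝒲 → ℝ) (r : 𝒰 → ℝ) (x : 𝒳) (y : 𝒴) : Set ℝ :=
  {t | ∃ a b c : 𝒲 → 𝒰 → ℝ, IsFeasible q r x y a b c ∧ (∀ w u, c w u = 0 → b w u = 0) ∧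
    t = ∑ w, ∑ u, a w u * b w u / c w u}

/-!
The true values `P(x, y, w, u)`, `P(w, u)` and `P(x, w, u)` of the unknowns form a feasible point,
by the Fréchet bounds, and its objective value is `P(y | do(x))` by back-door adjustment.

For the adjustment, let the children of `X` see the constant `x` while `X` keeps its distribution.
This model lives on the graph without the arrows out of `X`, where the back-door criterion is plain
d-separation. It gives events not involving `X` their probability under `do(x)`, and it agrees with
the original model on events inside `{X = x}` and on events about nondescendants of `X`.

In a d-separated situation the factors of non-ancestors of `X`, `Y`, `Z` sum out, and every other
factor involves only `Z` and nodes reached from `X` by active trails, or else only nodes not so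
reached. Exchanging the reached coordinates between two assignments with the same values on `Z` then
preserves the product of their weights, which is conditional independence of `X` and `Y` given `Z`.
-/

/-! ### d-separation -/

/-- `Z` d-separates `X` from `Y`: it blocks every path between them. -/
def IsDSeparated {V : Type*} (G : Digraph V) (Z : Finset V) (X Y : V) : Prop :=
  ∀ p, G.IsPath X Y p → G.IsBlocked Z p

/-- The ancestors of the nodes of `s`, including these nodes themselves. -/
def ancestors {V : Type*} (G : Digraph V) (s : Set V) : Set V :=
  {v | ∃ u ∈ s, G.IsDescendant v u}

/-- A set of nodes is ancestral if it contains the parents of all of its members. -/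
def IsAncestral {V : Type*} (G : Digraph V) (A : Set V) : Prop :=
  ∀ ⦃u v⦄, G.Adj u v → v ∈ A → u ∈ A

/-- The family of a node: the node and its parents. -/
def family {V : Type*} (G : Digraph V) (v : V) : Set V :=
  {u | u = v ∨ G.Adj u v}

/-- The mark that an arrow carries at one of its two ends. -/
inductive ArrowMark
  | tail
  | head

/-- An active trail that has arrived at `v`, its last arrow having the mark `m` there, may be
prolonged to `w`, where the new arrow has the mark `n`. The starting node of a trail counts as
entered through a tail. -/
inductive ActiveStep {V : Type*} (G : Digraph V) (Z : Finset V) :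
    V → ArrowMark → V → ArrowMark → Prop
  | up_of_tail {v w : V} : G.Adj w v → v ∉ Z → ActiveStep G Z v .tail w .tail
  | up_of_head {v w : V} : G.Adj w v → v ∈ ancestors G Z → ActiveStep G Z v .head w .tail
  | down {v : V} {m : ArrowMark} {w : V} : G.Adj v w → v ∉ Z → ActiveStep G Z v m w .head

/-- Some active trail, possibly with repeated nodes, leads from `X` to the given node and enters
it with the given mark. -/
inductive ActiveReach {V : Type*} (G : Digraph V) (Z : Finset V) (X : V) : V → ArrowMark → Prop
  | start : ActiveReach G Z X X .tail
  | step {v m w n} : ActiveReach G Z X v m → ActiveStep G Z v m w n → ActiveReach G Z X w n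

/-- The list is an active trail from `X` without repeated nodes, its last node coming first. -/
inductive ActivePath {V : Type*} (G : Digraph V) (Z : Finset V) (X : V) :
    V → ArrowMark → List V → Prop
  | start : ActivePath G Z X X .tail [X]
  | step {v m l w n} : ActivePath G Z X v m l → w ∉ l → ActiveStep G Z v m w n →
      ActivePath G Z X w n (w :: l)

/-- The nodes outside `Z` that active trails from `X` reach. -/
def activeSet {V : Type*} (G : Digraph V) (Z : Finset V) (X : V) : Set V :=
  {v | v ∉ Z ∧ ∃ m, ActiveReach G Z X v m}

section DSeparation

variable {V : Type*} {G H : Digraph V} {Z : Finset V} {X Y v w : V} {m n : ArrowMark}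
  {l p : List V}

theorem subset_ancestors (s : Set V) : s ⊆ ancestors G s :=
  fun v hv => ⟨v, hv, .refl⟩

theorem mem_ancestors_of_isDescendant {s : Set V} (hvw : G.IsDescendant v w)
    (hw : w ∈ ancestors G s) : v ∈ ancestors G s :=
  let ⟨u, hu, hwu⟩ := hw
  ⟨u, hu, hvw.trans hwu⟩

theorem isAncestral_ancestors (s : Set V) : IsAncestral G (ancestors G s) :=
  fun _ _ huv => mem_ancestors_of_isDescendant (.single huv)

theorem family_subset_of_isAncestral {A : Set V} (hA : IsAncestral G A) (hv : v ∈ A) :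
    family G v ⊆ A := by
  rintro u (rfl | huv)
  · exact hv
  · exact hA huv hv

theorem exists_notMem_forall_adj_mem [Finite V] (hG : G.IsAcyclicDigraph) {A : Set V}
    (hA : A ≠ Set.univ) : ∃ v ∉ A, ∀ u, G.Adj u v → u ∈ A := by
  have : Std.Irrefl (Relation.TransGen G.Adj) := ⟨hG⟩
  obtain ⟨v, hv, hmin⟩ := (Finite.wellFounded_of_trans_of_irrefl
    (Relation.TransGen G.Adj)).has_min Aᶜ (Set.nonempty_compl.2 hA)
  exact ⟨v, hv, fun u huv => not_not.1 fun hu => hmin u hu (.single huv)⟩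

theorem not_adj_of_adj (hG : G.IsAcyclicDigraph) (hvw : G.Adj v w) : ¬ G.Adj w v :=
  fun hwv => hG v (.tail (.single hvw) hwv)

theorem not_adj_self (hG : G.IsAcyclicDigraph) (v : V) : ¬ G.Adj v v :=
  fun h => hG v (.single h)

theorem isAcyclicDigraph_of_le (hHG : H ≤ G) (hG : G.IsAcyclicDigraph) : H.IsAcyclicDigraph :=
  fun v hv => hG v (hv.lift id fun _ _ h => hHG h)

theorem isPath_cons (hl : G.IsPath v X l) (hw : w ∉ l) (hvw : G.Adj w v ∨ G.Adj v w) :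
    G.IsPath w X (w :: l) where
  chain := List.isChain_cons.2 ⟨by simpa [hl.head] using hvw, hl.chain⟩
  nodup := List.nodup_cons.2 ⟨hw, hl.nodup⟩
  head := rfl
  last := by simp [List.getLast?_cons, hl.last]

theorem isPath_reverse (hp : G.IsPath X Y p) : G.IsPath Y X p.reverse where
  chain := List.isChain_reverse.2 (hp.chain.imp fun _ _ => Or.symm)
  nodup := List.nodup_reverse.2 hp.nodup
  head := by rw [List.head?_reverse, hp.last]
  last := by rw [List.getLast?_reverse, hp.head]

theorem isBlocked_of_reverse (hp : G.IsBlocked Z p.reverse) : G.IsBlocked Z p := by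
  obtain ⟨A, B, C, hABC, hB⟩ := hp
  refine ⟨C, B, A, by simpa using List.reverse_infix.2 hABC, ?_⟩
  tauto

theorem isBlocked_of_le (hG : G.IsAcyclicDigraph) (hHG : H ≤ G)
    (hp : p.IsChain fun u v => H.Adj u v ∨ H.Adj v u) (hb : G.IsBlocked Z p) :
    H.IsBlocked Z p := by
  obtain ⟨A, B, C, hABC, hB⟩ := hb
  have hchain := hp.infix hABC
  simp only [List.isChain_cons_cons, List.isChain_singleton, and_true] at hchain
  -- By acyclicity, the arrow of `G` between two consecutive nodes is the one of `H`.
  have adj_of_adj : ∀ {a b}, G.Adj a b → H.Adj a b ∨ H.Adj b a → H.Adj a b :=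
    fun hab h => h.resolve_right fun hba => not_adj_of_adj hG hab (hHG hba)
  obtain ⟨hAB, hBC⟩ := hchain
  refine ⟨A, B, C, hABC, hB.imp (.imp_left ?_) ?_⟩
  · exact .imp (.imp (adj_of_adj · hAB) (adj_of_adj · hBC))
      (.imp (.imp (adj_of_adj · hBC.symm) (adj_of_adj · hAB.symm))
        (.imp (adj_of_adj · hAB.symm) (adj_of_adj · hBC)))
  · exact .imp (.imp (adj_of_adj · hAB) (adj_of_adj · hBC.symm))
      fun h D hBD => h D (hBD.lift id fun _ _ h => hHG h)

theorem ActiveStep.adj (h : ActiveStep G Z v m w n) :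
    (n = .tail ∧ G.Adj w v) ∨ (n = .head ∧ G.Adj v w) := by
  cases h <;> simp_all

theorem ActiveStep.of_mark (h : ActiveStep G Z v m w n) {m' : ArrowMark}
    (htail : m' = .tail → v ∉ Z) (hhead : m' = .head → v ∈ ancestors G Z) :
    ActiveStep G Z v m' w n := by
  cases h with
  | down hvw hv => exact .down hvw hv
  | up_of_tail hwv | up_of_head hwv =>
    cases m' with
    | tail => exact .up_of_tail hwv (htail rfl)
    | head => exact .up_of_head hwv (hhead rfl)

theorem ActivePath.isPath (h : ActivePath G Z X v m l) : G.IsPath v X l := by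
  induction h with
  | start => exact ⟨by simp, by simp, rfl, rfl⟩
  | step _ hw hs ih => exact isPath_cons ih hw (hs.adj.imp And.right And.right)

theorem ActivePath.adj_of_cons_cons (h : ActivePath G Z X v m (v :: w :: l)) :
    (m = .tail ∧ G.Adj v w) ∨ (m = .head ∧ G.Adj w v) := by
  cases h with
  | step h _ hs =>
    obtain rfl := by simpa using h.isPath.head
    exact hs.adj

theorem ActivePath.not_isBlocked (hG : G.IsAcyclicDigraph) (h : ActivePath G Z X v m l) :
    ¬ G.IsBlocked Z l := by
  induction h with
  | start =>
    rintro ⟨A, B, C, hABC, -⟩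
    simpa using hABC.length_le
  | @step v m l w n h _ hs ih =>
    rintro ⟨A, B, C, hABC, hB⟩
    rcases List.infix_cons_iff.1 hABC with ⟨t, ht⟩ | hABC
    · simp only [List.cons_append, List.nil_append, List.cons.injEq] at ht
      obtain ⟨rfl, rfl⟩ := ht
      obtain rfl : B = v := by simpa using h.isPath.head
      have hBC := h.adj_of_cons_cons
      cases hs with
      | up_of_tail hAB hBZ =>
        have hBC := (hBC.resolve_right (by simp)).2
        exact hB.elim (fun hB => hBZ hB.2) fun hB => not_adj_of_adj hG hBC hB.1.2
      | up_of_head hAB hBZ =>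
        have hCB := (hBC.resolve_left (by simp)).2
        obtain ⟨D, hD, hBD⟩ := hBZ
        have hBA := not_adj_of_adj hG hAB
        have hBC := not_adj_of_adj hG hCB
        exact hB.elim (by tauto) fun hB => hB.2 D hBD hD
      | down hBA hBZ =>
        exact hB.elim (fun hB => hBZ hB.2) fun hB => not_adj_of_adj hG hBA hB.1.1
    · exact ih ⟨A, B, C, hABC, hB⟩

theorem ActivePath.exists_of_mem (h : ActivePath G Z X v m l) (hw : w ∈ l) (hwv : w ≠ v) :
    ∃ n l', ActivePath G Z X w n l' ∧ (n = .tail → w ∉ Z) ∧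
      (n = .head → w ∈ ancestors G Z ∨ m = .head ∧ G.IsDescendant w v) := by
  induction h with
  | start => exact absurd (by simpa using hw) hwv
  | @step u k l v m h _ hs ih =>
    have hwl : w ∈ l := (List.mem_cons.1 hw).resolve_left hwv
    by_cases hwu : w = u
    · subst hwu
      refine ⟨k, l, h, ?_⟩
      cases hs with
      | up_of_tail _ hwZ => exact ⟨fun _ => hwZ, nofun⟩
      | up_of_head _ hwZ => exact ⟨nofun, fun _ => .inl hwZ⟩
      | down hwv hwZ => exact ⟨fun _ => hwZ, fun _ => .inr ⟨rfl, .single hwv⟩⟩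
    · obtain ⟨n, l', hl', htail, hhead⟩ := ih hwl hwu
      refine ⟨n, l', hl', htail, fun hn => (hhead hn).elim .inl ?_⟩
      rintro ⟨rfl, hwu⟩
      cases hs with
      | up_of_head _ huZ => exact .inl (mem_ancestors_of_isDescendant hwu huZ)
      | down huv _ => exact .inr ⟨rfl, hwu.tail huv⟩

/-- When a trail returns to a node `w` of its path, the loop is cut off. This can turn `w` into a
collider only if the loop returns along an arrow out of `w`; the directed stretch of the loop that
starts at `w` then ends at an open collider, so `w` has a descendant in `Z`. -/
theorem ActiveReach.exists_activePath (hG : G.IsAcyclicDigraph) (h : ActiveReach G Z X v m) :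
    ∃ n l, ActivePath G Z X v n l ∧ ∀ w k, ActiveStep G Z v m w k → ActiveStep G Z v n w k := by
  induction h with
  | start => exact ⟨_, _, .start, fun _ _ => id⟩
  | @step v m w k _ hs ih =>
    obtain ⟨m', l, hl, hsteps⟩ := ih
    replace hs := hsteps _ _ hs
    by_cases hw : w ∈ l
    · have hwv : w ≠ v := by
        rintro rfl
        exact hs.adj.elim (fun h => not_adj_self hG _ h.2) fun h => not_adj_self hG _ h.2
      obtain ⟨n, l', hl', htail, hhead⟩ := hl.exists_of_mem hw hwv
      refine ⟨n, l', hl', fun u j hj => ?_⟩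
      by_cases hnk : n = k
      · exact hnk ▸ hj
      · refine hj.of_mark htail fun hn => (hhead hn).elim id ?_
        rintro ⟨rfl, hwv⟩
        cases hs with
        | up_of_head _ hvZ => exact mem_ancestors_of_isDescendant hwv hvZ
        | down => exact absurd hn hnk
    · exact ⟨k, w :: l, .step hl hw hs, fun _ _ => id⟩

theorem IsDSeparated.not_activeReach (hG : G.IsAcyclicDigraph) (hsep : IsDSeparated G Z X Y)
    (m : ArrowMark) : ¬ ActiveReach G Z X Y m := by
  intro h
  obtain ⟨n, l, hl, -⟩ := h.exists_activePath hG
  exact hl.not_isBlocked hG (isBlocked_of_reverse (hsep _ (isPath_reverse hl.isPath)))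

theorem ActiveReach.exists_of_isDescendant (h : ActiveReach G Z X v m)
    (hvw : G.IsDescendant v w) (hv : v ∉ ancestors G Z) : ∃ n, ActiveReach G Z X w n := by
  induction hvw with
  | refl => exact ⟨m, h⟩
  | @tail b c hvb hbc ih =>
    obtain ⟨n, hn⟩ := ih
    exact ⟨.head, .step hn (.down hbc fun hb => hv ⟨b, hb, hvb⟩)⟩

theorem activeReach_tail_of_isDescendant (hvX : G.IsDescendant v X) (hv : v ∉ ancestors G Z) :
    ActiveReach G Z X v .tail := by
  induction hvX using Relation.ReflTransGen.head_induction_on with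
  | refl => exact .start
  | @head a b hab _ ih =>
    have hb : b ∉ ancestors G Z := fun hb => hv (isAncestral_ancestors _ hab hb)
    exact .step (ih hb) (.up_of_tail hab fun hbZ => hb (subset_ancestors _ hbZ))

theorem mem_activeSet_union_of_activeReach (h : ActiveReach G Z X v m) :
    v ∈ activeSet G Z X ∪ Z :=
  or_iff_not_imp_right.2 fun hv => ⟨hv, m, h⟩

theorem family_subset_of_activeReach_tail (h : ActiveReach G Z X v .tail) (hv : v ∉ Z) :
    family G v ⊆ activeSet G Z X ∪ Z := by
  rintro u (rfl | huv)
  · exact mem_activeSet_union_of_activeReach h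
  · exact mem_activeSet_union_of_activeReach (h.step (.up_of_tail huv hv))

theorem family_subset_of_activeReach_head (hY : ∀ m, ¬ ActiveReach G Z X Y m)
    (hv : v ∈ ancestors G (insert X (insert Y Z))) (h : ActiveReach G Z X v .head) :
    family G v ⊆ activeSet G Z X ∪ Z := by
  by_cases hvZ : v ∈ ancestors G Z
  · rintro u (rfl | huv)
    · exact mem_activeSet_union_of_activeReach h
    · exact mem_activeSet_union_of_activeReach (h.step (.up_of_head huv hvZ))
  · obtain ⟨u, rfl | rfl | hu, hvu⟩ := hv
    · exact family_subset_of_activeReach_tail (activeReach_tail_of_isDescendant hvu hvZ)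
        fun hv => hvZ (subset_ancestors _ hv)
    · obtain ⟨n, hn⟩ := h.exists_of_isDescendant hvu hvZ
      exact absurd hn (hY n)
    · exact absurd ⟨u, hu, hvu⟩ hvZ

theorem family_subset_or_disjoint_activeSet (hY : ∀ m, ¬ ActiveReach G Z X Y m)
    (hv : v ∈ ancestors G (insert X (insert Y Z))) :
    family G v ⊆ activeSet G Z X ∪ Z ∨ Disjoint (family G v) (activeSet G Z X) := by
  rw [or_iff_not_imp_right, Set.not_disjoint_iff]
  rintro ⟨u, rfl | huv, huZ, m, hu⟩
  · cases m with
    | tail => exact family_subset_of_activeReach_tail hu huZ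
    | head => exact family_subset_of_activeReach_head hY hv hu
  · exact family_subset_of_activeReach_head hY hv (hu.step (.down huv huZ))

end DSeparation

section Severing

variable {V : Type*} {G : Digraph V} {Z : Finset V} {X Y : V}

/-- The graph `G` without the arrows out of `X`, in which the back-door paths are the only paths
left between `X` and another node. -/
def severOutgoing (G : Digraph V) (X : V) : Digraph V where
  Adj u v := G.Adj u v ∧ u ≠ X

theorem severOutgoing_le (G : Digraph V) (X : V) : severOutgoing G X ≤ G :=
  fun _ _ h => h.1

theorem isDSeparated_severOutgoing (hG : G.IsAcyclicDigraph) (hXY : X ≠ Y)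
    (hZ : G.BackDoor X Y Z) : IsDSeparated (severOutgoing G X) Z X Y := by
  intro p hp
  have hle := severOutgoing_le G X
  refine isBlocked_of_le hG hle hp.chain (hZ.blocked p
    ⟨hp.chain.imp fun u v h => h.imp (@hle u v) (@hle v u), hp.nodup, hp.head, hp.last⟩ ?_)
  match p, hp with
  | [u], hp => exact absurd (by simpa using hp.head.symm.trans hp.last) hXY
  | u :: A :: l, hp =>
    obtain rfl : u = X := by simpa using hp.head
    have hA := (List.isChain_cons_cons.1 hp.chain).1.resolve_left fun h => h.2 rfl
    exact ⟨A, by simp, hA.1⟩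

end Severing

/-! ### Weights of events -/

/-- The total weight of the event `E` under the weight function `p`. By definition, `M.prob` and
`M.doProb X x` are the event weights of `M.joint` and `M.doJoint X x`. -/
noncomputable def eventWeight {Ω : Type*} [Fintype Ω] (p : Ω → ℝ) (E : Set Ω) : ℝ :=
  ∑ ω, E.indicator p ω

section EventWeight

variable {Ω : Type*} [Fintype Ω] {p : Ω → ℝ}

theorem eventWeight_mono (hp : ∀ ω, 0 ≤ p ω) {E F : Set Ω} (h : E ⊆ F) :
    eventWeight p E ≤ eventWeight p F :=
  sum_le_sum fun ω _ => Set.indicator_le_indicator_of_subset h hp ω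

theorem eventWeight_nonneg (hp : ∀ ω, 0 ≤ p ω) (E : Set Ω) : 0 ≤ eventWeight p E :=
  sum_nonneg fun ω _ => Set.indicator_nonneg (fun ω _ => hp ω) ω

theorem eventWeight_union_add_inter (p : Ω → ℝ) (E F : Set Ω) :
    eventWeight p (E ∪ F) + eventWeight p (E ∩ F) = eventWeight p E + eventWeight p F := by
  simp only [eventWeight, ← sum_add_distrib]
  exact sum_congr rfl fun ω _ => congrFun (Set.indicator_union_add_inter p E F) ω

theorem sum_eventWeight_of_mem_iff {ι : Type*} [Fintype ι] (p : Ω → ℝ) {E : ι → Set Ω} {F : Set Ω}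
    (g : Ω → ι) (hE : ∀ i ω, ω ∈ E i ↔ ω ∈ F ∧ g ω = i) :
    ∑ i, eventWeight p (E i) = eventWeight p F := by
  classical
  unfold eventWeight
  rw [sum_comm]
  refine sum_congr rfl fun ω _ => ?_
  simp only [Set.indicator_apply, hE, ite_and]
  split_ifs <;> simp

theorem eventWeight_eq_sum_indicator_mul (p : Ω → ℝ) (E : Set Ω) :
    eventWeight p E = ∑ ω, E.indicator 1 ω * p ω :=
  sum_congr rfl fun ω _ => by rw [← Set.indicator_mul_left]; simp

theorem max_zero_sub_one_le_eventWeight_inter (hp : ∀ ω, 0 ≤ p ω)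
    (hp₁ : eventWeight p Set.univ ≤ 1) (E F : Set Ω) :
    max 0 (eventWeight p E + eventWeight p F - 1) ≤ eventWeight p (E ∩ F) := by
  refine max_le (eventWeight_nonneg hp _) ?_
  have hunion := eventWeight_mono hp (Set.subset_univ (E ∪ F))
  linarith [eventWeight_union_add_inter p E F]

theorem eventWeight_inter_le_min (hp : ∀ ω, 0 ≤ p ω) (E F : Set Ω) :
    eventWeight p (E ∩ F) ≤ min (eventWeight p E) (eventWeight p F) :=
  le_min (eventWeight_mono hp Set.inter_subset_left) (eventWeight_mono hp Set.inter_subset_right)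

end EventWeight

/-! ### Events about some of the coordinates -/

/-- `E` is the event that the coordinates in `Z` have certain prescribed values, or `E` is
empty. -/
def IsValueEvent {V : Type*} {S : V → Type*} (Z : Finset V) (E : Set (∀ v, S v)) : Prop :=
  ∀ ω ∈ E, ∀ ω', ω' ∈ E ↔ ∀ v ∈ Z, ω v = ω' v

section Coordinates

variable {V : Type*} {S : V → Type*} {A : Set V} {Z : Finset V} {E F : Set (∀ v, S v)}

theorem dependsOn_mem_inter (hE : DependsOn (· ∈ E) A) (hF : DependsOn (· ∈ F) A) :
    DependsOn (· ∈ E ∩ F) A :=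
  fun _ _ h => congrArg₂ And (hE h) (hF h)

theorem dependsOn_eval_eq (v : V) (s : S v) : DependsOn (· ∈ {ω : ∀ v, S v | ω v = s}) {v} :=
  fun _ _ h => congrArg (· = s) (h v rfl)

theorem dependsOn_indicator (hE : DependsOn (· ∈ E) A) :
    DependsOn (E.indicator (1 : (∀ v, S v) → ℝ)) A := by
  classical
  intro ω ω' h
  have hωω' : ω ∈ E ↔ ω' ∈ E := iff_of_eq (hE h)
  simp only [Set.indicator_apply, hωω', Pi.one_apply]

theorem dependsOn_mul {F G : (∀ v, S v) → ℝ} (hF : DependsOn F A) (hG : DependsOn G A) :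
    DependsOn (fun ω => F ω * G ω) A :=
  fun _ _ h => congrArg₂ (· * ·) (hF h) (hG h)

theorem dependsOn_prod {f : V → (∀ v, S v) → ℝ} {B : Finset V}
    (hf : ∀ v ∈ B, DependsOn (f v) A) : DependsOn (fun ω => ∏ v ∈ B, f v ω) A :=
  fun _ _ h => prod_congr rfl fun v hv => hf v hv h

theorem IsValueEvent.dependsOn (hE : IsValueEvent Z E) : DependsOn (· ∈ E) (Z : Set V) :=
  fun ω ω' h => propext ⟨fun hω => (hE ω hω ω').2 h,
    fun hω' => (hE ω' hω' ω).2 fun v hv => (h v hv).symm⟩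

theorem isValueEvent_restrict_inter_restrict [DecidableEq V] (W U : Finset V)
    (w : ∀ v : W, S v) (u : ∀ v : U, S v) :
    IsValueEvent (W ∪ U) {ω : ∀ v, S v | W.restrict ω = w ∧ U.restrict ω = u} := by
  rintro ω ⟨rfl, rfl⟩ ω'
  simp only [Set.mem_ofPred_eq, funext_iff, restrict, Subtype.forall, mem_union, or_imp,
    forall_and, eq_comm]

end Coordinates

section Exchange

variable {V : Type*} {S : V → Type*} {R : Set V} {Z : Finset V}

open scoped Classical in
theorem mul_piecewise_of_dependsOn {K : Set V} {F : (∀ v, S v) → ℝ} (hF : DependsOn F K)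
    (hK : K ⊆ R ∪ Z ∨ Disjoint K R) {ω ω' : ∀ v, S v} (hω : ∀ v ∈ Z, ω v = ω' v) :
    F (R.piecewise ω' ω) * F (R.piecewise ω ω') = F ω * F ω' := by
  rcases hK with hK | hK
  · have onK : ∀ a b : ∀ v, S v, (∀ v ∈ Z, a v = b v) → F (R.piecewise a b) = F a := by
      refine fun a b hab => hF fun v hv => ?_
      by_cases hvR : v ∈ R
      · exact Set.piecewise_eq_of_mem _ _ _ hvR
      · rw [Set.piecewise_eq_of_notMem _ _ _ hvR, hab v ((hK hv).resolve_left hvR)]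
    rw [onK ω' ω fun v hv => (hω v hv).symm, onK ω ω' hω, mul_comm]
  · have offK : ∀ a b : ∀ v, S v, F (R.piecewise a b) = F b := fun a b =>
      hF fun v hv => Set.piecewise_eq_of_notMem _ _ _ (hK.notMem_of_mem_left hv)
    rw [offK, offK]

open scoped Classical in
theorem prod_piecewise_activeSet_mul {G : Digraph V} {f : V → (∀ v, S v) → ℝ}
    (hf : ∀ v, DependsOn (f v) (family G v)) {A : Finset V} {X Y : V}
    (hY : ∀ m, ¬ ActiveReach G Z X Y m)
    (hA : ∀ v ∈ A, v ∈ ancestors G (insert X (insert Y Z))) {ω ω' : ∀ v, S v}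
    (hω : ∀ v ∈ Z, ω v = ω' v) :
    (∏ v ∈ A, f v ((activeSet G Z X).piecewise ω' ω)) *
        ∏ v ∈ A, f v ((activeSet G Z X).piecewise ω ω') =
      (∏ v ∈ A, f v ω) * ∏ v ∈ A, f v ω' := by
  simp only [← prod_mul_distrib]
  exact prod_congr rfl fun v hv =>
    mul_piecewise_of_dependsOn (hf v) (family_subset_or_disjoint_activeSet hY (hA v hv)) hω

variable [Fintype V] [DecidableEq V] [∀ v, Fintype (S v)]

open scoped Classical in
/-- Exchanging the coordinates in `R` is an involution on pairs of assignments; it carries the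
terms of the product on the left to those of the product on the right. -/
theorem eventWeight_mul_of_exchange {p : (∀ v, S v) → ℝ} (hRZ : Disjoint (Z : Set V) R)
    (hp : ∀ ω ω', (∀ v ∈ Z, ω v = ω' v) →
      p (R.piecewise ω' ω) * p (R.piecewise ω ω') = p ω * p ω')
    {A B E : Set (∀ v, S v)} (hE : IsValueEvent Z E) (hA : DependsOn (· ∈ A) R)
    (hB : DependsOn (· ∈ B) Rᶜ) :
    eventWeight p (B ∩ E) * eventWeight p (A ∩ E) =
      eventWeight p (A ∩ B ∩ E) * eventWeight p E := by
  let swap : (∀ v, S v) × (∀ v, S v) → (∀ v, S v) × (∀ v, S v) := fun q =>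
    (R.piecewise q.2 q.1, R.piecewise q.1 q.2)
  have hswap : Function.Involutive swap := by
    rintro ⟨ω, ω'⟩
    ext v <;> by_cases hv : v ∈ R <;> simp [swap, hv]
  simp only [eventWeight, sum_mul_sum, ← Fintype.sum_prod_type']
  refine Fintype.sum_equiv hswap.toPerm _ _ fun ⟨ω, ω'⟩ => ?_
  have onR : ∀ a b : ∀ v, S v, ∀ v ∈ R, R.piecewise a b v = a v := fun a b v hv =>
    Set.piecewise_eq_of_mem _ _ _ hv
  have offR : ∀ a b : ∀ v, S v, ∀ v ∉ R, R.piecewise a b v = b v := fun a b v hv =>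
    Set.piecewise_eq_of_notMem _ _ _ hv
  have hmemA : R.piecewise ω' ω ∈ A ↔ ω' ∈ A := iff_of_eq (hA (onR ω' ω))
  have hmemB : R.piecewise ω' ω ∈ B ↔ ω ∈ B := iff_of_eq (hB (offR ω' ω))
  have hmemE : ∀ a b, R.piecewise a b ∈ E ↔ b ∈ E := fun a b =>
    iff_of_eq (hE.dependsOn fun v hv => offR a b v (hRZ.notMem_of_mem_left hv))
  simp only [Function.Involutive.coe_toPerm, swap, Set.indicator_apply, Set.mem_inter_iff, hmemA,
    hmemB, hmemE]
  by_cases hω : ω ∈ E <;> by_cases hω' : ω' ∈ E <;> simp only [hω, hω', and_false, and_true,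
    if_false, if_true, zero_mul, mul_zero]
  have hpω := hp ω ω' ((hE ω hω ω').1 hω')
  by_cases hA' : ω' ∈ A <;> by_cases hB' : ω ∈ B <;> simp [hA', hB', hpω]

end Exchange

/-! ### Products of conditional distributions -/

/-- A family of conditional distributions along `G`: the factor `f v` depends on the values of
`v` and its parents only, and it sums to `1` over the values of `v`. -/
structure IsConditionalFamily {V : Type*} [DecidableEq V] {S : V → Type*} [∀ v, Fintype (S v)]
    (G : Digraph V) (f : V → (∀ v, S v) → ℝ) : Prop where
  dependsOn : ∀ v, DependsOn (f v) (family G v)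
  sum_update : ∀ v ω, ∑ s, f v (Function.update ω v s) = 1

section ConditionalFamily

variable {V : Type*} {S : V → Type*} [∀ v, Fintype (S v)] {G H : Digraph V}
  {f f' : V → (∀ v, S v) → ℝ}

theorem prod_card_ne_zero [Nonempty (∀ v, S v)] (A : Finset V) :
    ∏ v ∈ A, (Fintype.card (S v) : ℝ) ≠ 0 :=
  have hS : ∀ v, Nonempty (S v) := Classical.nonempty_pi.1 ‹_›
  prod_ne_zero_iff.2 fun v _ => Nat.cast_ne_zero.2 Fintype.card_ne_zero

variable [DecidableEq V]

theorem IsConditionalFamily.of_le (hHG : H ≤ G) (hf : IsConditionalFamily H f) :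
    IsConditionalFamily G f :=
  ⟨fun v => (hf.dependsOn v).mono fun _ hu => hu.imp_right (@hHG _ _), hf.sum_update⟩

variable [Fintype V]

theorem sum_sum_update {R : Type*} [AddCommMonoid R] (v : V) (h : (∀ v, S v) → R) :
    ∑ ω, ∑ s, h (Function.update ω v s) = Fintype.card (S v) • ∑ ω, h ω := by
  let swap : (∀ v, S v) × S v → (∀ v, S v) × S v := fun q => (Function.update q.1 v q.2, q.1 v)
  have hswap : Function.Involutive swap := fun q => by simp [swap]
  calc ∑ ω, ∑ s, h (Function.update ω v s) = ∑ q : (∀ v, S v) × S v, h (swap q).1 :=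
        (Fintype.sum_prod_type' fun ω s => h (Function.update ω v s)).symm
    _ = ∑ q : (∀ v, S v) × S v, h q.1 := Equiv.sum_comp hswap.toPerm fun q => h q.1
    _ = Fintype.card (S v) • ∑ ω, h ω := by
        rw [Fintype.sum_prod_type_right' fun ω (_ : S v) => h ω, sum_const, card_univ]

theorem sum_eq_card_mul_sum_mul {v : V} {F h : (∀ v, S v) → ℝ} (hF : DependsOn F {v}ᶜ)
    (hh : ∀ ω, ∑ s, h (Function.update ω v s) = 1) :
    ∑ ω, F ω = Fintype.card (S v) * ∑ ω, F ω * h ω := by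
  have hF' : ∀ ω s, F (Function.update ω v s) = F ω := fun ω s =>
    hF fun u hu => Function.update_of_ne hu _ _
  rw [← nsmul_eq_mul, ← sum_sum_update]
  simp only [hF', ← mul_sum, hh, mul_one]

/-- The factors outside an ancestral set sum out, later nodes first. Since all sums run over full
assignments, each of these coordinates leaves behind the number of its values. -/
theorem sum_mul_prod_of_isAncestral (hG : G.IsAcyclicDigraph) (hf : IsConditionalFamily G f)
    {A : Finset V} (hA : IsAncestral G A) {g : (∀ v, S v) → ℝ} (hg : DependsOn g A) :
    ∑ ω, g ω * ∏ v ∈ A, f v ω =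
      (∏ v ∈ Aᶜ, (Fintype.card (S v) : ℝ)) * ∑ ω, g ω * ∏ v, f v ω := by
  induction A using WellFoundedGT.induction with
  | ind A ih =>
    rcases eq_or_ne A univ with rfl | hne
    · simp
    obtain ⟨m, hmA, hpa⟩ := exists_notMem_forall_adj_mem hG (A := A) (by simpa using hne)
    have hins : IsAncestral G (insert m A : Finset V) := by
      intro u v huv hv
      rcases mem_insert.1 hv with rfl | hv
      · exact mem_insert_of_mem (hpa u huv)
      · exact mem_insert_of_mem (hA huv hv)
    have hfree : DependsOn (fun ω => g ω * ∏ v ∈ A, f v ω) {m}ᶜ :=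
      (dependsOn_mul hg (dependsOn_prod fun v hv =>
        (hf.dependsOn v).mono (family_subset_of_isAncestral hA hv))).mono
          (Set.subset_compl_singleton_iff.2 hmA)
    calc ∑ ω, g ω * ∏ v ∈ A, f v ω
        = Fintype.card (S m) * ∑ ω, g ω * ∏ v ∈ insert m A, f v ω := by
          rw [sum_eq_card_mul_sum_mul hfree (hf.sum_update m)]
          simp only [prod_insert hmA, mul_assoc, mul_comm (f m _)]
      _ = (∏ v ∈ Aᶜ, (Fintype.card (S v) : ℝ)) * ∑ ω, g ω * ∏ v, f v ω := by
          rw [ih _ (ssubset_insert hmA) hins (hg.mono (by simp)), ← mul_assoc,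
            compl_insert, mul_prod_erase _ (fun v => (Fintype.card (S v) : ℝ)) (mem_compl.2 hmA)]

theorem eventWeight_prod_of_isAncestral (hG : G.IsAcyclicDigraph) (hf : IsConditionalFamily G f)
    {A : Finset V} (hA : IsAncestral G A) {E : Set (∀ v, S v)} (hE : DependsOn (· ∈ E) A) :
    eventWeight (fun ω => ∏ v ∈ A, f v ω) E =
      (∏ v ∈ Aᶜ, (Fintype.card (S v) : ℝ)) * eventWeight (fun ω => ∏ v, f v ω) E := by
  simp only [eventWeight_eq_sum_indicator_mul]
  exact sum_mul_prod_of_isAncestral hG hf hA (dependsOn_indicator hE)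

theorem eventWeight_prod_congr (hG : G.IsAcyclicDigraph) (hf : IsConditionalFamily G f)
    (hf' : IsConditionalFamily G f') {A : Finset V} (hA : IsAncestral G A)
    (hff' : ∀ v ∈ A, f v = f' v) {E : Set (∀ v, S v)} (hE : DependsOn (· ∈ E) A) :
    eventWeight (fun ω => ∏ v, f v ω) E = eventWeight (fun ω => ∏ v, f' v ω) E := by
  rcases isEmpty_or_nonempty (∀ v, S v) with hΩ | hΩ
  · simp [eventWeight]
  refine mul_left_cancel₀ (prod_card_ne_zero (S := S) Aᶜ) ?_
  rw [← eventWeight_prod_of_isAncestral hG hf hA hE, ← eventWeight_prod_of_isAncestral hG hf' hA hE]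
  simp only [prod_congr rfl fun v hv => congrFun (hff' v hv) _]

theorem eventWeight_prod_univ_le_one (hG : G.IsAcyclicDigraph) (hf : IsConditionalFamily G f) :
    eventWeight (fun ω => ∏ v, f v ω) Set.univ ≤ 1 := by
  rcases isEmpty_or_nonempty (∀ v, S v) with hΩ | hΩ
  · simp [eventWeight]
  have hcard : (Fintype.card (∀ v, S v) : ℝ) ≠ 0 := Nat.cast_ne_zero.2 Fintype.card_ne_zero
  have htotal := eventWeight_prod_of_isAncestral hG hf (A := ∅) (E := Set.univ)
    (fun _ _ _ h => by simp at h) fun _ _ _ => rfl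
  rw [compl_empty, ← Nat.cast_prod, ← Fintype.card_pi] at htotal
  refine (mul_left_cancel₀ hcard ?_).le
  simpa [eventWeight] using htotal.symm

/-- The global Markov property: only the factors of the ancestors of `X`, `Y` and `Z` count, and
each of them stays on one side of the cut along `activeSet`. -/
theorem eventWeight_mul_of_isDSeparated (hG : G.IsAcyclicDigraph) (hf : IsConditionalFamily G f)
    {Z : Finset V} {X Y : V} (hsep : IsDSeparated G Z X Y) (hXZ : X ∉ Z)
    {A B E : Set (∀ v, S v)} (hA : DependsOn (· ∈ A) {X}) (hB : DependsOn (· ∈ B) {Y})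
    (hE : IsValueEvent Z E) :
    eventWeight (fun ω => ∏ v, f v ω) (B ∩ E) * eventWeight (fun ω => ∏ v, f v ω) (A ∩ E) =
      eventWeight (fun ω => ∏ v, f v ω) (A ∩ B ∩ E) * eventWeight (fun ω => ∏ v, f v ω) E := by
  classical
  rcases isEmpty_or_nonempty (∀ v, S v) with hΩ | hΩ
  · simp [eventWeight]
  have hY := hsep.not_activeReach hG
  obtain ⟨N, hN⟩ : ∃ N : Finset V, N = ancestors G (insert X (insert Y (Z : Set V))) :=
    ⟨_, Set.coe_toFinset _⟩
  have hNanc : IsAncestral G N := hN ▸ isAncestral_ancestors _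
  have hsub : insert X (insert Y (Z : Set V)) ⊆ N := hN ▸ subset_ancestors _
  have hNA : DependsOn (· ∈ A) N := hA.mono fun v hv => hsub (.inl hv)
  have hNB : DependsOn (· ∈ B) N := hB.mono fun v hv => hsub (.inr (.inl hv))
  have hNE : DependsOn (· ∈ E) N := hE.dependsOn.mono fun v hv => hsub (.inr (.inr hv))
  have hexchange := eventWeight_mul_of_exchange (p := fun ω => ∏ v ∈ N, f v ω)
    (Set.disjoint_left.2 fun v hv h => h.1 hv)
    (fun ω ω' => prod_piecewise_activeSet_mul hf.dependsOn hY fun v hv => hN ▸ mem_coe.2 hv)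
    hE (hA.mono (Set.singleton_subset_iff.2 ⟨hXZ, _, .start⟩))
    (hB.mono (Set.singleton_subset_iff.2 fun h => h.2.elim hY))
  have hweight := fun (D : Set (∀ v, S v)) (hD : DependsOn (· ∈ D) N) =>
    eventWeight_prod_of_isAncestral hG hf hNanc hD
  rw [hweight _ (dependsOn_mem_inter hNB hNE), hweight _ (dependsOn_mem_inter hNA hNE),
    hweight _ (dependsOn_mem_inter (dependsOn_mem_inter hNA hNB) hNE), hweight _ hNE] at hexchange
  have hcard := prod_card_ne_zero (S := S) Nᶜ
  refine mul_left_cancel₀ (mul_ne_zero hcard hcard) ?_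
  linear_combination hexchange

end ConditionalFamily

/-! ### Interventions and back-door adjustment -/

namespace CausalModel

variable {V : Type*} {G H : Digraph V} {S : V → Type*} [∀ v, Fintype (S v)]

theorem factor_nonneg (M : CausalModel G S) (v : V) (ω : ∀ v, S v) : 0 ≤ M.factor v ω :=
  M.cpt_nonneg _ _ _

theorem joint_nonneg [Fintype V] (M : CausalModel G S) (ω : ∀ v, S v) : 0 ≤ M.joint ω :=
  prod_nonneg fun v _ => M.factor_nonneg v ω

variable [DecidableEq V]

theorem isConditionalFamily_cpt (M : CausalModel G S) (hH : H.IsAcyclicDigraph)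
    {pa : (∀ v, S v) → ∀ v, S v}
    (hpa : ∀ u v, G.Adj u v → DependsOn (fun ω => pa ω u) {w | H.Adj w v}) :
    IsConditionalFamily H fun v ω => M.cpt v (fun u => pa ω u) (ω v) where
  dependsOn v ω ω' h := congrArg₂ (M.cpt v)
    (funext fun u => hpa u v u.2 fun w hw => h w (.inr hw)) (h v (.inl rfl))
  sum_update v ω := by
    have hpa_update : ∀ s, (fun u : {u // G.Adj u v} => pa (Function.update ω v s) u) =
        fun u : {u // G.Adj u v} => pa ω u := fun s => funext fun u => hpa u v u.2 fun w hw =>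
      Function.update_of_ne (by rintro rfl; exact not_adj_self hH _ hw) _ _
    simp only [hpa_update, Function.update_self, M.cpt_sum]

theorem isConditionalFamily_factor (M : CausalModel G S) (hG : G.IsAcyclicDigraph) :
    IsConditionalFamily G M.factor :=
  M.isConditionalFamily_cpt hG (pa := id) fun u _ huv _ _ h => h u huv

/-- The factor of `v` in the model in which the children of `X` see the constant `x` in place of
`X`, while `X` itself keeps its distribution. -/
def severedFactor (M : CausalModel G S) (X : V) (x : S X) (v : V) (ω : ∀ v, S v) : ℝ :=
  M.cpt v (fun u => Function.update ω X x u) (ω v)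

theorem isConditionalFamily_severedFactor (M : CausalModel G S) (hG : G.IsAcyclicDigraph) (X : V)
    (x : S X) : IsConditionalFamily (severOutgoing G X) (M.severedFactor X x) := by
  refine M.isConditionalFamily_cpt (isAcyclicDigraph_of_le (severOutgoing_le G X) hG)
    fun u v huv ω ω' h => ?_
  rcases eq_or_ne u X with rfl | huX
  · simp only [Function.update_self]
  · simpa only [Function.update_of_ne huX] using h u ⟨huv, huX⟩

theorem severedFactor_of_eq (M : CausalModel G S) {X : V} {x : S X} {ω : ∀ v, S v}
    (hω : ω X = x) (v : V) : M.severedFactor X x v ω = M.factor v ω := by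
  rw [severedFactor, ← hω, Function.update_eq_self, factor]

theorem severedFactor_of_not_adj (M : CausalModel G S) {X v : V} (x : S X) (hXv : ¬ G.Adj X v) :
    M.severedFactor X x v = M.factor v :=
  funext fun ω => congrArg (M.cpt v · (ω v)) <| funext fun u =>
    Function.update_of_ne (by rintro rfl; exact hXv u.2) _ _

variable [Fintype V]

theorem doJoint_nonneg (M : CausalModel G S) (X : V) (x : S X) (ω : ∀ v, S v) :
    0 ≤ M.doJoint X x ω :=
  Set.indicator_nonneg (fun ω _ => prod_nonneg fun v _ => M.factor_nonneg v ω) ω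

theorem prob_univ_le_one (M : CausalModel G S) (hG : G.IsAcyclicDigraph) :
    M.prob Set.univ ≤ 1 :=
  eventWeight_prod_univ_le_one hG (M.isConditionalFamily_factor hG)

/-- The joint distribution of the model in which the children of `X` see the constant `x`. -/
def severedJoint (M : CausalModel G S) (X : V) (x : S X) (ω : ∀ v, S v) : ℝ :=
  ∏ v, M.severedFactor X x v ω

variable {M : CausalModel G S} {X Y : V} {x : S X} {E : Set (∀ v, S v)}

theorem eventWeight_severedJoint_of_subset (hE : E ⊆ {ω | ω X = x}) :
    eventWeight (M.severedJoint X x) E = M.prob E := by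
  refine sum_congr rfl fun ω _ => congrFun (Set.indicator_congr fun ω hω => ?_) ω
  exact prod_congr rfl fun v _ => M.severedFactor_of_eq (hE hω) v

theorem eventWeight_severedJoint_of_dependsOn (hG : G.IsAcyclicDigraph)
    (hE : DependsOn (· ∈ E) {v | ¬ G.IsDescendant X v}) :
    eventWeight (M.severedJoint X x) E = M.prob E := by
  classical
  have hsevered := (M.isConditionalFamily_severedFactor hG X x).of_le (severOutgoing_le G X)
  refine eventWeight_prod_congr hG hsevered (M.isConditionalFamily_factor hG)
    (A := {v | ¬ G.IsDescendant X v}) ?_ (fun v hv => ?_) (by simpa using hE)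
  · intro u v huv hv
    simp only [coe_filter, mem_univ, true_and, Set.mem_ofPred_eq] at hv ⊢
    exact fun hXu => hv (hXu.tail huv)
  · exact M.severedFactor_of_not_adj x fun hXv => (mem_filter.1 hv).2 (.single hXv)

/-- Neither the distribution of `X` nor the point mass at `x` matters for events that do not
involve `X`, since both sum out. -/
theorem doProb_eq_eventWeight_severedJoint (hG : G.IsAcyclicDigraph)
    (hE : DependsOn (· ∈ E) {X}ᶜ) :
    M.doProb X x E = eventWeight (M.severedJoint X x) E := by
  have hcond := M.isConditionalFamily_severedFactor hG X x
  have hfree : DependsOn (fun ω => E.indicator 1 ω * ∏ v ∈ univ.erase X, M.severedFactor X x v ω)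
      {X}ᶜ := by
    refine dependsOn_mul (dependsOn_indicator hE) (dependsOn_prod fun v hv => ?_)
    refine (hcond.dependsOn v).mono ?_
    rintro u (rfl | huv)
    · exact (mem_erase.1 hv).1
    · exact huv.2
  have hpoint : ∀ ω : ∀ v, S v,
      ∑ s, {ω : ∀ v, S v | ω X = x}.indicator (1 : (∀ v, S v) → ℝ) (Function.update ω X s) = 1 := by
    classical
    simp [Set.indicator_apply]
  have hcard : (Fintype.card (S X) : ℝ) ≠ 0 :=
    Nat.cast_ne_zero.2 (Fintype.card_pos_iff.2 ⟨x⟩).ne'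
  calc M.doProb X x E
      = ∑ ω, E.indicator 1 ω * (∏ v ∈ univ.erase X, M.severedFactor X x v ω) *
          {ω : ∀ v, S v | ω X = x}.indicator 1 ω := by
        rw [doProb, ← eventWeight, eventWeight_eq_sum_indicator_mul]
        refine sum_congr rfl fun ω _ => ?_
        by_cases hω : ω X = x <;> simp [doJoint, hω, M.severedFactor_of_eq]
    _ = ∑ ω, E.indicator 1 ω * (∏ v ∈ univ.erase X, M.severedFactor X x v ω) *
          M.severedFactor X x X ω :=
        mul_left_cancel₀ hcard ((sum_eq_card_mul_sum_mul hfree hpoint).symm.trans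
          (sum_eq_card_mul_sum_mul hfree (hcond.sum_update X)))
    _ = eventWeight (M.severedJoint X x) E := by
        simp only [eventWeight_eq_sum_indicator_mul, severedJoint, mul_assoc,
          prod_erase_mul univ (M.severedFactor X x · _) (mem_univ X)]

theorem doProb_eq_prob (hG : G.IsAcyclicDigraph)
    (hE : DependsOn (· ∈ E) {v | ¬ G.IsDescendant X v}) : M.doProb X x E = M.prob E := by
  have hX : {v | ¬ G.IsDescendant X v} ⊆ {X}ᶜ := by
    rintro v hv rfl
    exact hv .refl
  rw [doProb_eq_eventWeight_severedJoint hG (hE.mono hX),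
    eventWeight_severedJoint_of_dependsOn hG hE]

theorem doProb_mul_prob_of_backDoor (hG : G.IsAcyclicDigraph) (hXY : X ≠ Y) {Z : Finset V}
    (hZ : G.BackDoor X Y Z) (hE : IsValueEvent Z E) (y : S Y) :
    M.doProb X x ({ω | ω Y = y} ∩ E) * M.prob ({ω | ω X = x} ∩ E) =
      M.prob ({ω | ω X = x} ∩ ({ω | ω Y = y} ∩ E)) * M.prob E := by
  have hsep := isDSeparated_severOutgoing hG hXY hZ
  have hXZ : X ∉ Z := fun hX => hZ.not_descendant X hX .refl
  have hXE : DependsOn (· ∈ E) {X}ᶜ := hE.dependsOn.mono (by simpa using hXZ)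
  have hXYE : DependsOn (· ∈ {ω | ω Y = y} ∩ E) {X}ᶜ :=
    dependsOn_mem_inter ((dependsOn_eval_eq Y y).mono (by simpa using hXY)) hXE
  have hmarkov := eventWeight_mul_of_isDSeparated
    (isAcyclicDigraph_of_le (severOutgoing_le G X) hG) (M.isConditionalFamily_severedFactor hG X x)
    hsep hXZ (dependsOn_eval_eq X x) (dependsOn_eval_eq Y y) hE
  rw [doProb_eq_eventWeight_severedJoint hG hXYE,
    ← eventWeight_severedJoint_of_subset Set.inter_subset_left,
    ← eventWeight_severedJoint_of_subset Set.inter_subset_left,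
    ← eventWeight_severedJoint_of_dependsOn (x := x) hG (hE.dependsOn.mono hZ.not_descendant),
    ← Set.inter_assoc]
  exact hmarkov

theorem doProb_eq_div_of_backDoor (hG : G.IsAcyclicDigraph) (hXY : X ≠ Y) {Z : Finset V}
    (hZ : G.BackDoor X Y Z) (hE : IsValueEvent Z E)
    (hpos : 0 < M.prob E → 0 < M.prob ({ω | ω X = x} ∩ E)) (y : S Y) :
    M.doProb X x ({ω | ω Y = y} ∩ E) =
      M.prob ({ω | ω X = x} ∩ ({ω | ω Y = y} ∩ E)) * M.prob E / M.prob ({ω | ω X = x} ∩ E) := by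
  have hprob : 0 ≤ M.prob E := eventWeight_nonneg M.joint_nonneg E
  rcases hprob.eq_or_lt with hzero | hE_pos
  · have hle : M.doProb X x ({ω | ω Y = y} ∩ E) ≤ M.prob E :=
      (eventWeight_mono (M.doJoint_nonneg X x) Set.inter_subset_right).trans_eq
        (doProb_eq_prob hG (hE.dependsOn.mono hZ.not_descendant))
    rw [← hzero, mul_zero, zero_div]
    exact (hle.trans_eq hzero.symm).antisymm (eventWeight_nonneg (M.doJoint_nonneg X x) _)
  · exact eq_div_of_mul_eq (hpos hE_pos).ne' (doProb_mul_prob_of_backDoor hG hXY hZ hE y)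

theorem causalEffect_eq_sum_div (hG : G.IsAcyclicDigraph) (hXY : X ≠ Y) {W U : Finset V}
    (hZ : G.BackDoor X Y (W ∪ U)) (y : S Y)
    (hpos : ∀ (w : ∀ v : W, S v) (u : ∀ v : U, S v),
      0 < M.prob {ω | W.restrict ω = w ∧ U.restrict ω = u} →
        0 < M.prob {ω | ω X = x ∧ W.restrict ω = w ∧ U.restrict ω = u}) :
    M.causalEffect X Y x y = ∑ w, ∑ u,
      M.prob {ω | ω X = x ∧ ω Y = y ∧ W.restrict ω = w ∧ U.restrict ω = u} *
        M.prob {ω | W.restrict ω = w ∧ U.restrict ω = u} /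
          M.prob {ω | ω X = x ∧ W.restrict ω = w ∧ U.restrict ω = u} := by
  calc M.causalEffect X Y x y
      = ∑ w, M.doProb X x {ω | ω Y = y ∧ W.restrict ω = w} :=
        (sum_eventWeight_of_mem_iff (M.doJoint X x) W.restrict fun _ _ => .rfl).symm
    _ = ∑ w, ∑ u, M.doProb X x {ω | ω Y = y ∧ W.restrict ω = w ∧ U.restrict ω = u} :=
        sum_congr rfl fun w _ => (sum_eventWeight_of_mem_iff (M.doJoint X x)
          (F := {ω | ω Y = y ∧ W.restrict ω = w}) U.restrict fun _ _ => and_assoc.symm).symm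
    _ = _ := sum_congr rfl fun w _ => sum_congr rfl fun u _ => doProb_eq_div_of_backDoor hG hXY hZ
        (isValueEvent_restrict_inter_restrict W U w u) (hpos w u) y

end CausalModel

/-! ### The optimization problem -/

section Optimization

variable {𝒳 𝒴 𝒲 𝒰 : Type*} [Fintype 𝒳] [Fintype 𝒴] [Fintype 𝒰]

theorem isFeasible_eventWeight {Ω : Type*} [Fintype Ω] {p : Ω → ℝ} (hp : ∀ ω, 0 ≤ p ω)
    (hp₁ : eventWeight p Set.univ ≤ 1) (X : Ω → 𝒳) (Y : Ω → 𝒴) (W : Ω → 𝒲) (U : Ω → 𝒰)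
    (x : 𝒳) (y : 𝒴) :
    IsFeasible (fun x y w => eventWeight p {ω | X ω = x ∧ Y ω = y ∧ W ω = w})
      (fun u => eventWeight p {ω | U ω = u}) x y
      (fun w u => eventWeight p {ω | X ω = x ∧ Y ω = y ∧ W ω = w ∧ U ω = u})
      (fun w u => eventWeight p {ω | W ω = w ∧ U ω = u})
      (fun w u => eventWeight p {ω | X ω = x ∧ W ω = w ∧ U ω = u}) := by
  have hXW : ∀ x w, ∑ y, eventWeight p {ω | X ω = x ∧ Y ω = y ∧ W ω = w} =
      eventWeight p {ω | X ω = x ∧ W ω = w} := fun x w =>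
    sum_eventWeight_of_mem_iff p Y fun y ω => by simp only [Set.mem_ofPred_eq]; tauto
  have hW : ∀ w, ∑ x, eventWeight p {ω | X ω = x ∧ W ω = w} = eventWeight p {ω | W ω = w} :=
    fun w => sum_eventWeight_of_mem_iff p X fun x ω => and_comm
  have hXYWU : ∀ w u, {ω | X ω = x ∧ Y ω = y ∧ W ω = w ∧ U ω = u} =
      {ω | X ω = x ∧ Y ω = y ∧ W ω = w} ∩ {ω | U ω = u} := fun w u => by
    ext ω; simp only [Set.mem_ofPred_eq, Set.mem_inter_iff, and_assoc]
  have hXWU : ∀ w u, {ω | X ω = x ∧ W ω = w ∧ U ω = u} =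
      {ω | X ω = x ∧ W ω = w} ∩ {ω | U ω = u} := fun w u => by
    ext ω; simp only [Set.mem_ofPred_eq, Set.mem_inter_iff, and_assoc]
  have lower := max_zero_sub_one_le_eventWeight_inter hp hp₁
  have upper := eventWeight_inter_le_min hp
  constructor <;> simp only [hXW, hW, hXYWU, hXWU]
  case sum_a => exact fun w => sum_eventWeight_of_mem_iff p U fun _ _ => .rfl
  case sum_b => exact fun w => sum_eventWeight_of_mem_iff p U fun _ _ => .rfl
  case sum_c => exact fun w => sum_eventWeight_of_mem_iff p U fun _ _ => .rfl
  case c_le_b => exact fun w u => eventWeight_mono hp fun ω hω => ⟨hω.1.2, hω.2⟩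
  case a_le_c => exact fun w u => eventWeight_mono hp fun ω hω => ⟨⟨hω.1.1, hω.1.2.2⟩, hω.2⟩
  case le_a | le_b | le_c => exact fun w u => lower _ _
  case a_le | b_le | c_le => exact fun w u => upper _ _

theorem objectiveValues_subset_Icc [Fintype 𝒲] (q : 𝒳 → 𝒴 → 𝒲 → ℝ) (r : 𝒰 → ℝ) (x : 𝒳) (y : 𝒴) :
    objectiveValues q r x y ⊆ Set.Icc 0 (∑ w, ∑ x', ∑ y', q x' y' w) := by
  rintro t ⟨a, b, c, h, -, rfl⟩
  have ha : ∀ w u, 0 ≤ a w u := fun w u => (le_max_left _ _).trans (h.le_a w u)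
  have hb : ∀ w u, 0 ≤ b w u := fun w u => (le_max_left _ _).trans (h.le_b w u)
  have hc : ∀ w u, 0 ≤ c w u := fun w u => (le_max_left _ _).trans (h.le_c w u)
  refine ⟨sum_nonneg fun w _ => sum_nonneg fun u _ =>
    div_nonneg (mul_nonneg (ha w u) (hb w u)) (hc w u), ?_⟩
  simp only [← h.sum_b]
  refine sum_le_sum fun w _ => sum_le_sum fun u _ => div_le_of_le_mul₀ (hc w u) (hb w u) ?_
  rw [mul_comm]
  exact mul_le_mul_of_nonneg_left (h.a_le_c w u) (hb w u)

end Optimization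

theorem theorem1 {V : Type*} [Fintype V] [DecidableEq V] (G : Digraph V)
    (hG : G.IsAcyclicDigraph) (S : V → Type*) [∀ v, Fintype (S v)] (M : CausalModel G S)
    (X Y : V) (hXY : X ≠ Y) (W U : Finset V) (hZ : G.BackDoor X Y (W ∪ U))
    (x : S X) (y : S Y)
    (hpos : ∀ (w : ∀ v : W, S v) (u : ∀ v : U, S v),
      0 < M.prob {ω | W.restrict ω = w ∧ U.restrict ω = u} →
        0 < M.prob {ω | ω X = x ∧ W.restrict ω = w ∧ U.restrict ω = u}) :
    (objectiveValues (M.tableXYW X Y W) (M.tableU U) x y).Nonempty ∧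
    BddBelow (objectiveValues (M.tableXYW X Y W) (M.tableU U) x y) ∧
    BddAbove (objectiveValues (M.tableXYW X Y W) (M.tableU U) x y) ∧
    sInf (objectiveValues (M.tableXYW X Y W) (M.tableU U) x y) ≤ M.causalEffect X Y x y ∧
    M.causalEffect X Y x y ≤ sSup (objectiveValues (M.tableXYW X Y W) (M.tableU U) x y) := by
  have hmem : M.causalEffect X Y x y ∈ objectiveValues (M.tableXYW X Y W) (M.tableU U) x y := by
    refine ⟨_, _, _, isFeasible_eventWeight M.joint_nonneg (M.prob_univ_le_one hG) (· X) (· Y)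
      W.restrict U.restrict x y, fun w u hc => ?_,
      CausalModel.causalEffect_eq_sum_div hG hXY hZ y hpos⟩
    by_contra hb
    have hb_pos := (eventWeight_nonneg M.joint_nonneg _).lt_of_ne' hb
    exact (hpos w u hb_pos).ne' hc
  have hbdd := objectiveValues_subset_Icc (M.tableXYW X Y W) (M.tableU U) x y
  have hbelow := bddBelow_Icc.mono hbdd
  have habove := bddAbove_Icc.mono hbdd
  exact ⟨⟨_, hmem⟩, hbelow, habove, csInf_le hbelow hmem, le_csSup habove hmem⟩
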